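/- Let $\tau$ be a real number and let $h$ be an entire function of exponential type $\tau$, that is, $h:\mathbb{C}\to\mathbb{C}$ is holomorphic and for every $\epsilon>0$ the inequality $|h(z)|\le e^{(\tau+\epsilon)|z|}$ holds for all sufficiently large $|z|$. Assume that $h$ is absolutely integrable on $[0,\infty)$, i.e. $\int_0^\infty |h(x)|\,dx<\infty$, and that for all $z\in\mathbb{C}$ $$h(z)=z^{2m}\sum_{j=0}^{\infty} b_j z^{2j},$$ where $m$ is a non-negative integer, the $b_j$ are complex numbers and $b_0\neq 0$. Let $l$ be a non-negative integer and let $J_{2l+1}$ be the Bessel function of the first kind of order $2l+1$, where $J_n(z)=\sum_{k=0}^\infty \frac{(-1)^k}{k!\,(n+k)!}\left(\frac z2\right)^{2k+n}$ for $n\in\mathbb{N}$. If $\lambda>\tau$ is real, then the integral $\int_0^\infty h(x)J_{2l+1}(\lambda x)\,dx$ converges absolutely, $$\int_0^\infty h(x)J_{2l+1}(\lambda x)\,dx=0\qquad\text{if } l<m,$$ and $$\int_0^\infty h(x)J_{2l+1}(\lambda x)\,dx=\frac12\sum_{j=0}^{l-m} b_j\,\frac{(l+m+j)!}{(l-m-j)!}\left(\frac{2}{\lambda}\right)^{2m+2j+1}\qquad\text{if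 } l\ge m.$$ -/

import Mathlib

/-- `h : ℂ → ℂ` is an entire function of exponential type `τ`: it is holomorphic on all of `ℂ` and,
for every `ε > 0`, `|h z| ≤ exp ((τ + ε) |z|)` for all sufficiently large `|z|`. -/
def IsEntireOfExpType (τ : ℝ) (h : ℂ → ℂ) : Prop :=
  Differentiable ℂ h ∧
    ∀ ε : ℝ, 0 < ε → ∃ R : ℝ, ∀ z : ℂ, R ≤ ‖z‖ → ‖h z‖ ≤ Real.exp ((τ + ε) * ‖z‖)

/-- The Bessel function of the first kind `J_n` of order `n ∈ ℕ`,
`J_n(z) = ∑_{k ≥ 0} (-1)^k / (k! (n + k)!) (z / 2)^(2 k + n)`. -/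
noncomputable def besselJ (n : ℕ) (z : ℂ) : ℂ :=
  ∑' k : ℕ, (-1 : ℂ) ^ k / ((k.factorial : ℂ) * ((n + k).factorial : ℂ)) * (z / 2) ^ (2 * k + n)

/-- The series that defines `J_n` converges absolutely for every complex argument. -/
theorem summable_besselJ (n : ℕ) (z : ℂ) :
    Summable fun k : ℕ =>
      (-1 : ℂ) ^ k / ((k.factorial : ℂ) * ((n + k).factorial : ℂ)) * (z / 2) ^ (2 * k + n) := by
  refine Summable.of_norm_bounded
    (g := fun k : ℕ => ‖z / 2‖ ^ n * ((‖z / 2‖ ^ 2) ^ k / (k.factorial : ℝ)))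
    ((Real.summable_pow_div_factorial _).mul_left _) fun k => ?_
  have h1 : (1 : ℝ) ≤ ((n + k).factorial : ℝ) := by
    exact_mod_cast Nat.one_le_iff_ne_zero.mpr (Nat.factorial_ne_zero _)
  have h0 : (0 : ℝ) < (k.factorial : ℝ) := by exact_mod_cast Nat.factorial_pos k
  have h2 : ‖(-1 : ℂ) ^ k / ((k.factorial : ℂ) * ((n + k).factorial : ℂ))‖
      ≤ 1 / (k.factorial : ℝ) := by
    rw [norm_div, norm_mul, norm_pow, norm_neg, norm_one, one_pow, Complex.norm_natCast,
      Complex.norm_natCast]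
    exact one_div_le_one_div_of_le h0 (le_mul_of_one_le_right h0.le h1)
  calc _ = ‖(-1 : ℂ) ^ k / ((k.factorial : ℂ) * ((n + k).factorial : ℂ))‖
          * ‖z / 2‖ ^ (2 * k + n) := by rw [norm_mul, norm_pow]
    _ ≤ 1 / (k.factorial : ℝ) * ‖z / 2‖ ^ (2 * k + n) := by gcongr
    _ = _ := by rw [pow_add, pow_mul]; ring

/-! Fold Bessel's integral to `πi J_{2l+1}(t) = ∫ sin((2l+1)θ) e^{it sin θ} dθ` over `[-π/2, π/2]`.
Fubini turns the integral of `h(x) J_{2l+1}(λx)` into that of `sin((2l+1)θ) G(λ sin θ)`, up to the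
factor `1/(πi)`, where `G` is `halfFourier h`, holomorphic in the upper half-plane and continuous up
to the real axis. Write `h = ∑ c_k z^{2k}`. For `τ < ρ < λ` and `|w| > ρ`, `G` equals the Borel
transform `∑ c_k (2k)! (i/w)^{2k+1}`, even at real `w` (`halfFourier_eq_borelSum`). This series is
odd in `w`, so the vertical sides cancel when the segment is moved up to height `T`
(`integral_sin_mul_halfFourier_shift`). On the raised segment the series is integrated termwise.
With `q = e^{iz}`, each power of `1 / sin z` is a power series in `q`, and orthogonality leaves one
term if `k ≤ l` and none otherwise (`integral_sin_mul_inv_sin_pow`). Hence the sum is finite, and it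
vanishes when `l < m`. -/

open MeasureTheory Complex Set

/-! ### Bessel's integral -/

/-- Integrals of `e^{ikθ}` over a period. -/
theorem integral_exp_int_mul_period (k : ℤ) :
    ∫ θ in (-Real.pi)..Real.pi, exp (k * θ * I) = if k = 0 then 2 * (Real.pi : ℂ) else 0 := by
  split_ifs with hk
  · subst hk; simp; ring
  · have hc : (k * I : ℂ) ≠ 0 := by simp [hk]
    have : ∀ θ : ℝ, exp (k * θ * I) = exp ((k * I) * θ) := fun θ => by ring_nf
    simp_rw [this]
    rw [integral_exp_mul_complex hc, div_eq_zero_iff]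
    left
    rw [sub_eq_zero, Complex.exp_eq_exp_iff_exists_int]
    exact ⟨k, by push_cast; ring⟩

/-- Integrals of `e^{2ip(θ+iT)}` over half a period. -/
theorem integral_exp_two_mul_half_period (p : ℤ) (T : ℝ) :
    ∫ θ in (-(Real.pi / 2))..(Real.pi / 2), exp (2 * p * (θ + T * I) * I) =
      if p = 0 then (Real.pi : ℂ) else 0 := by
  split_ifs with hp
  · subst hp; simp
  · have hc : (2 * p * I : ℂ) ≠ 0 := by simp [hp]
    have : ∀ θ : ℝ, exp (2 * p * (θ + T * I) * I) =
        exp ((2 * p * I) * θ) * exp (2 * p * (T * I) * I) := fun θ => by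
      rw [← Complex.exp_add]; ring_nf
    simp_rw [this]
    rw [intervalIntegral.integral_mul_const, integral_exp_mul_complex hc, mul_eq_zero,
      div_eq_zero_iff]
    left; left
    rw [sub_eq_zero, Complex.exp_eq_exp_iff_exists_int]
    exact ⟨p, by push_cast; ring⟩

theorem Complex.hasSum_mul_of_summable_norm {ι κ : Type*} {f : ι → ℂ} {g : κ → ℂ} {a b : ℂ}
    (hf : HasSum f a) (hg : HasSum g b)
    (hf' : Summable fun i => ‖f i‖) (hg' : Summable fun k => ‖g k‖) :
    HasSum (fun p : ι × κ => f p.1 * g p.2) (a * b) :=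
  hf.mul hg (summable_mul_of_summable_norm hf' hg')

theorem hasSum_pow_div_factorial (u : ℂ) :
    HasSum (fun j : ℕ => u ^ j / (j.factorial : ℂ)) (exp u) := by
  rw [Complex.exp_eq_exp_ℂ]; exact NormedSpace.expSeries_div_hasSum_exp u

theorem summable_norm_pow_div_factorial (u : ℂ) :
    Summable (fun j : ℕ => ‖u ^ j / (j.factorial : ℂ)‖) :=
  (hasSum_pow_div_factorial u).summable.norm

theorem hasSum_exp_mul_exp (u v : ℂ) :
    HasSum (fun p : ℕ × ℕ => u ^ p.1 / (p.1.factorial : ℂ) * (v ^ p.2 / (p.2.factorial : ℂ)))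
      (exp u * exp v) := by
  have h := hasSum_mul_of_summable_norm (hasSum_pow_div_factorial u) (hasSum_pow_div_factorial v)
    (summable_norm_pow_div_factorial u) (summable_norm_pow_div_factorial v)
  exact h

/-- The generating function `exp((t/2)(u - 1/u))` at `u = e^{iz}`, left as a product of two
exponential series: the double sum converges absolutely and needs no regrouping. -/
theorem hasSum_exp_mul_sin (t z : ℂ) :
    HasSum (fun p : ℕ × ℕ => (t / 2) ^ p.1 / (p.1.factorial : ℂ) *
      ((-(t / 2)) ^ p.2 / (p.2.factorial : ℂ)) * exp (((p.1 : ℤ) - (p.2 : ℤ) : ℤ) * z * I))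
      (exp (t * sin z * I)) := by
  have h3 := hasSum_exp_mul_exp (t / 2 * exp (z * I)) (-(t / 2) * exp (-z * I))
  have e : t / 2 * exp (z * I) + -(t / 2) * exp (-z * I) = t * sin z * I := by
    have := Complex.two_sin z
    linear_combination (-(t * I / 2)) * this - (t / 2) * (exp (-z * I) - exp (z * I)) * I_sq
  rw [← Complex.exp_add, e] at h3
  refine (congrArg (fun f => HasSum f _) (funext fun p => ?_)).mp h3
  have : exp ((((p.1 : ℤ) - (p.2 : ℤ) : ℤ) : ℂ) * z * I) =
      exp (z * I) ^ p.1 * exp (-z * I) ^ p.2 := by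
    rw [← Complex.exp_nat_mul, ← Complex.exp_nat_mul, ← Complex.exp_add]
    push_cast
    ring_nf
  rw [this, mul_pow, mul_pow]
  ring

/-- Bessel's integral `J_n(t) = (2π)⁻¹ ∫ e^{i(t sin θ - nθ)} dθ`. -/
theorem besselJ_eq_integral_period (n : ℕ) (t : ℂ) :
    ∫ θ in (-Real.pi)..Real.pi, exp (-(n * θ * I)) * exp (t * sin θ * I) =
      2 * Real.pi * besselJ n t := by
  have hs := fun θ : ℝ => (hasSum_exp_mul_sin t θ).mul_left (exp (-(n * θ * I)))
  have e1 : ∀ (p : ℕ × ℕ) (θ : ℝ), exp (-(n * θ * I)) * ((t / 2) ^ p.1 / (p.1.factorial : ℂ) *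
      ((-(t / 2)) ^ p.2 / (p.2.factorial : ℂ)) * exp (((p.1 : ℤ) - (p.2 : ℤ) : ℤ) * θ * I)) =
      (t / 2) ^ p.1 / (p.1.factorial : ℂ) * ((-(t / 2)) ^ p.2 / (p.2.factorial : ℂ)) *
        exp ((((p.1 : ℤ) - (p.2 : ℤ) - n : ℤ) : ℂ) * θ * I) := fun p θ => by
    have : exp ((((p.1 : ℤ) - (p.2 : ℤ) - n : ℤ) : ℂ) * θ * I) =
        exp (-(n * θ * I)) * exp (((p.1 : ℤ) - (p.2 : ℤ) : ℤ) * θ * I) := by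
      rw [← Complex.exp_add]; push_cast; ring_nf
    rw [this]; ring
  simp_rw [e1] at hs
  have key : ∀ u : ℂ, Summable (fun j : ℕ => ‖u ^ j / (j.factorial : ℂ)‖) := fun u =>
    (NormedSpace.expSeries_div_hasSum_exp u).summable.norm
  have hb : Summable (fun p : ℕ × ℕ => ‖(t / 2) ^ p.1 / (p.1.factorial : ℂ)‖ *
      ‖(-(t / 2)) ^ p.2 / (p.2.factorial : ℂ)‖) :=
    (key _).mul_of_nonneg (key _) (fun _ => norm_nonneg _) (fun _ => norm_nonneg _)
  have hi := intervalIntegral.hasSum_integral_of_dominated_convergence (μ := volume)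
    (a := -Real.pi) (b := Real.pi)
    (fun (p : ℕ × ℕ) (_ : ℝ) => ‖(t / 2) ^ p.1 / (p.1.factorial : ℂ)‖ *
      ‖(-(t / 2)) ^ p.2 / (p.2.factorial : ℂ)‖)
    (fun p => (Continuous.aestronglyMeasurable (by fun_prop)))
    (fun p => Filter.Eventually.of_forall fun θ _ => by
      rw [norm_mul, norm_mul]
      have : ‖exp ((((p.1 : ℤ) - (p.2 : ℤ) - n : ℤ) : ℂ) * θ * I)‖ = 1 := by
        have := Complex.norm_exp_ofReal_mul_I ((((p.1 : ℤ) - (p.2 : ℤ) - n : ℤ) : ℝ) * θ)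
        push_cast at this ⊢
        exact this
      rw [this, mul_one])
    (Filter.Eventually.of_forall fun θ _ => hb)
    (by simp)
    (Filter.Eventually.of_forall fun θ _ => hs θ)
  simp_rw [intervalIntegral.integral_const_mul, integral_exp_int_mul_period] at hi
  -- Only the pairs `(k + n, k)` have frequency zero; they give the Bessel series.
  have hinj : Function.Injective (fun k : ℕ => (k + n, k)) := fun a b hab => by
    simpa using congrArg Prod.snd hab
  rw [← hinj.hasSum_iff] at hi
  · rw [besselJ, ← tsum_mul_left]
    refine (hi.tsum_eq.symm.trans (tsum_congr fun k => ?_))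
    simp only [Function.comp]
    rw [if_pos (by push_cast; ring), neg_pow, add_comm k n]
    ring
  · rintro ⟨a, b⟩ hab
    rw [if_neg, mul_zero]
    intro h
    exact hab ⟨b, by simp; omega⟩

/-- For odd order, Bessel's integral folds to half a period. -/
theorem besselJ_odd_eq_integral (l : ℕ) (t : ℂ) :
    ∫ θ in (-(Real.pi / 2))..(Real.pi / 2),
        sin ((2 * l + 1 : ℕ) * (θ : ℂ)) * exp (t * sin θ * I) =
      Real.pi * I * besselJ (2 * l + 1) t := by
  set n := 2 * l + 1 with hn
  set f : ℝ → ℂ := fun θ => exp (-(n * θ * I)) * exp (t * sin θ * I) with hf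
  have hfc : Continuous f := by fun_prop
  have hper : Function.Periodic f (2 * Real.pi) := fun θ => by
    simp only [hf]
    push_cast
    rw [Complex.sin_add_two_pi]
    congr 1
    rw [Complex.exp_eq_exp_iff_exists_int]
    exact ⟨-n, by push_cast; ring⟩
  -- Start the period at `-π/2`, then reflect its second half by `θ ↦ π - θ`, which fixes `sin θ`.
  have h1 := hper.intervalIntegral_add_eq (-Real.pi) (-(Real.pi / 2))
  have h2 : ∫ θ in (-Real.pi)..(-Real.pi + 2 * Real.pi), f θ =
      2 * Real.pi * besselJ n t := by
    rw [← besselJ_eq_integral_period]; congr 1; ring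
  rw [h2, ← intervalIntegral.integral_add_adjacent_intervals (b := Real.pi / 2)
    (hfc.intervalIntegrable _ _) (hfc.intervalIntegrable _ _)] at h1
  have h3 : ∫ θ in (Real.pi / 2)..(-(Real.pi / 2) + 2 * Real.pi), f θ =
      ∫ θ in (-(Real.pi / 2))..(Real.pi / 2), f (Real.pi - θ) := by
    rw [intervalIntegral.integral_comp_sub_left f Real.pi]; congr 1 <;> ring
  rw [h3, ← intervalIntegral.integral_add (hfc.intervalIntegrable _ _)
    (Continuous.intervalIntegrable (by fun_prop) _ _)] at h1
  have h4 : ∀ θ : ℝ, f θ + f (Real.pi - θ) =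
      -(2 * I) * (sin (n * (θ : ℂ)) * exp (t * sin θ * I)) := fun θ => by
    simp only [hf]
    push_cast
    rw [Complex.sin_pi_sub]
    have e : exp (-(n * (Real.pi - θ) * I)) = - exp (n * θ * I) := by
      have : -(n * (Real.pi - θ) * I) = n * θ * I - Real.pi * I - l * (2 * Real.pi * I) := by
        rw [hn]; push_cast; ring
      rw [this, Complex.exp_sub, Complex.exp_sub, Complex.exp_pi_mul_I,
        Complex.exp_nat_mul_two_pi_mul_I]
      ring
    rw [e]
    have hs := Complex.two_sin (n * (θ : ℂ))
    rw [show -(n * (θ : ℂ)) * I = -(n * θ * I) by ring] at hs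
    linear_combination (I * exp (t * sin θ * I)) * hs +
      (exp (-(n * θ * I)) - exp (n * θ * I)) * exp (t * sin θ * I) * I_sq
  simp_rw [h4] at h1
  rw [intervalIntegral.integral_const_mul] at h1
  have hI : (2 * I : ℂ) ≠ 0 := by simp
  apply mul_left_cancel₀ hI
  linear_combination h1 - 2 * (Real.pi : ℂ) * besselJ n t * I_sq

/-! ### The half-line Fourier transform -/

/-- The half-line Fourier transform `∫₀^∞ h(x) e^{iwx} dx`. -/
noncomputable def halfFourier (h : ℂ → ℂ) (w : ℂ) : ℂ :=
  ∫ x in Ioi (0 : ℝ), h x * exp (w * x * I)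

theorem norm_exp_mul_mul_I (w : ℂ) (x : ℝ) : ‖exp (w * x * I)‖ = Real.exp (-(w.im * x)) := by
  rw [Complex.norm_exp]; simp

theorem continuousOn_halfFourier {h : ℂ → ℂ} (hc : Continuous h)
    (hi : IntegrableOn (fun x : ℝ => h x) (Ioi 0)) :
    ContinuousOn (halfFourier h) {w | 0 ≤ w.im} := by
  refine continuousOn_of_dominated (bound := fun x : ℝ => ‖h x‖) (fun w _ => ?_) (fun w hw => ?_)
    hi.norm (Filter.Eventually.of_forall fun x => ?_)
  · exact Continuous.aestronglyMeasurable (by fun_prop)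
  · filter_upwards [ae_restrict_mem measurableSet_Ioi] with x hx
    rw [norm_mul, norm_exp_mul_mul_I]
    exact mul_le_of_le_one_right (norm_nonneg _)
      (Real.exp_le_one_iff.mpr (neg_nonpos.mpr (mul_nonneg hw (le_of_lt hx))))
  · exact Continuous.continuousOn (by fun_prop)

theorem differentiableOn_halfFourier {h : ℂ → ℂ} (hc : Continuous h)
    (hi : IntegrableOn (fun x : ℝ => h x) (Ioi 0)) :
    DifferentiableOn ℂ (halfFourier h) {w | 0 < w.im} := by
  intro w hw
  have hw : 0 < w.im := hw
  set δ := w.im / 2 with hδ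
  have hδ0 : 0 < δ := by positivity
  have hopen : IsOpen {v : ℂ | δ < v.im} := isOpen_lt continuous_const Complex.continuous_im
  have hbase : Integrable (fun x : ℝ => h x * exp (w * x * I)) (volume.restrict (Ioi 0)) := by
    refine hi.norm.mono' (Continuous.aestronglyMeasurable (by fun_prop)) ?_
    filter_upwards [ae_restrict_mem measurableSet_Ioi] with x hx
    rw [norm_mul, norm_exp_mul_mul_I]
    exact mul_le_of_le_one_right (norm_nonneg _)
      (Real.exp_le_one_iff.mpr (neg_nonpos.mpr (mul_nonneg hw.le (le_of_lt hx))))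
  refine ((hasDerivAt_integral_of_dominated_loc_of_deriv_le (μ := volume.restrict (Ioi 0))
    (s := {v : ℂ | δ < v.im}) (F := fun v (x : ℝ) => h x * exp (v * x * I))
    (F' := fun v (x : ℝ) => h x * (exp (v * x * I) * (x * I)))
    (bound := fun x : ℝ => ‖h x‖ * (1 / δ))
    (hopen.mem_nhds (by simp [hδ]; linarith)) ?_ hbase ?_ ?_ (hi.norm.mul_const _)
    ?_).2).differentiableAt.differentiableWithinAt
  · exact Filter.Eventually.of_forall fun v => Continuous.aestronglyMeasurable (by fun_prop)
  · exact Continuous.aestronglyMeasurable (by fun_prop)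
  · filter_upwards [ae_restrict_mem measurableSet_Ioi] with x hx v hv
    have hx : 0 < x := hx
    have hv : δ < v.im := hv
    rw [norm_mul, norm_mul, norm_exp_mul_mul_I, norm_mul, Complex.norm_real, Complex.norm_I,
      mul_one, Real.norm_of_nonneg hx.le]
    gcongr
    -- It remains to see `δx ≤ e^{x Im v}`, which follows from `1 + s ≤ e^s`.
    rw [Real.exp_neg, ← div_eq_inv_mul, div_le_div_iff₀ (Real.exp_pos _) hδ0, one_mul]
    have h1 := Real.add_one_le_exp (v.im * x)
    nlinarith [mul_pos (sub_pos.mpr hv) hx]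
  · refine Filter.Eventually.of_forall fun x v _ => ?_
    refine HasDerivAt.const_mul _ (HasDerivAt.cexp ?_)
    simpa [mul_assoc] using (hasDerivAt_id v).mul_const ((x : ℂ) * I)

/-! ### Growth of Taylor coefficients and the Borel transform -/

/-- Cauchy's estimate for the coefficients of an even power series. -/
theorem norm_coeff_mul_pow_le {h : ℂ → ℂ} {c : ℕ → ℂ}
    (hc : ∀ z, HasSum (fun k => c k * z ^ (2 * k)) (h z)) (hd : Differentiable ℂ h)
    {R M : ℝ} (hR : 0 < R) (hM : ∀ z : ℂ, ‖z‖ = R → ‖h z‖ ≤ M) (k : ℕ) :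
    ‖c k‖ * R ^ (2 * k) ≤ M := by
  -- Zeros at odd indices make this an ordinary power series, to which uniqueness of Taylor
  -- coefficients applies.
  set d : ℕ → ℂ := fun n => if Even n then c (n / 2) else 0 with hdd
  have hinj : Function.Injective (fun k : ℕ => 2 * k) := fun a b hab => by simpa using hab
  have h1 : ∀ z, HasSum (fun n => d n * z ^ n) (h z) := fun z => by
    rw [← hinj.hasSum_iff]
    · convert hc z using 2 with k
      simp [hdd]
    · intro n hn
      have : ¬ Even n := fun he => by
        obtain ⟨r, hr⟩ := he
        exact hn ⟨r, by simp; omega⟩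
      simp [hdd, this]
  have h2 : HasFPowerSeriesAt h (FormalMultilinearSeries.ofScalars ℂ d) 0 := by
    rw [hasFPowerSeriesAt_iff]
    refine Filter.Eventually.of_forall fun z => ?_
    simpa [FormalMultilinearSeries.coeff_ofScalars, mul_comm] using h1 z
  have h3 := (hd.analyticAt 0).hasFPowerSeriesAt
  have h4 := congrArg (fun p => FormalMultilinearSeries.coeff p (2 * k))
    (h2.eq_formalMultilinearSeries h3)
  simp only [FormalMultilinearSeries.coeff_ofScalars] at h4
  have h5 : d (2 * k) = c k := by simp [hdd]
  rw [h5] at h4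
  have h6 := Complex.norm_iteratedDeriv_le_of_forall_mem_sphere_norm_le (c := 0) (2 * k) hR
    hd.diffContOnCl (fun z hz => hM z (by simpa using hz))
  rw [h4, norm_div, Complex.norm_natCast]
  have hf : (0 : ℝ) < ((2 * k).factorial : ℝ) := by positivity
  rw [div_mul_eq_mul_div, div_le_iff₀ hf]
  rw [le_div_iff₀ (by positivity)] at h6
  linarith

theorem integral_pow_mul_exp_neg_mul_Ioi (n : ℕ) {y : ℝ} (hy : 0 < y) :
    ∫ x in Ioi (0 : ℝ), x ^ n * Real.exp (-(y * x)) = n.factorial / y ^ (n + 1) := by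
  have := Real.integral_rpow_mul_exp_neg_mul_Ioi (a := n + 1) (by positivity) hy
  rw [Real.Gamma_nat_eq_factorial] at this
  simp only [add_sub_cancel_right, Real.rpow_natCast] at this
  rw [this]
  have e : ((n : ℝ) + 1) = ((n + 1 : ℕ) : ℝ) := by push_cast; rfl
  rw [e, Real.rpow_natCast, one_div, inv_pow]
  field_simp

theorem integrableOn_pow_mul_exp_neg_mul_Ioi (n : ℕ) {y : ℝ} (hy : 0 < y) :
    IntegrableOn (fun x : ℝ => x ^ n * Real.exp (-(y * x))) (Ioi 0) := by
  -- A non-integrable function has integral `0` by convention, but the value here is positive.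
  by_contra hcon
  have h1 := integral_pow_mul_exp_neg_mul_Ioi n hy
  rw [integral_undef hcon] at h1
  exact absurd h1.symm (by positivity)

/-- Integrating Cauchy's estimate `|c_k| x^{2k} ≤ C e^{σx}` against `e^{-yx}` over all radii `x >
0`, with `σ < y < ρ`, bounds `|c_k| (2k)! / y^{2k+1}` by `C / (y - σ)`. Passing from `y` to `ρ`
gains a geometric factor. -/
theorem summable_coeff_mul_factorial {h : ℂ → ℂ} {c : ℕ → ℂ}
    (hc : ∀ z, HasSum (fun k => c k * z ^ (2 * k)) (h z)) (hd : Differentiable ℂ h)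
    {C σ ρ : ℝ} (hσ : 0 < σ) (hM : ∀ z : ℂ, ‖h z‖ ≤ C * Real.exp (σ * ‖z‖)) (hρ : σ < ρ) :
    Summable fun k => ‖c k‖ * ((2 * k).factorial / ρ ^ (2 * k + 1)) := by
  obtain ⟨y, hy1, hy2⟩ := exists_between hρ
  have hy0 : 0 < y := hσ.trans hy1
  have hρ0 : 0 < ρ := hy0.trans hy2
  have hb : ∀ k, ‖c k‖ * ((2 * k).factorial / y ^ (2 * k + 1)) ≤ C * (1 / (y - σ)) := fun k => by
    have i1 := integral_pow_mul_exp_neg_mul_Ioi 0 (sub_pos.mpr hy1)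
    have i2 := integrableOn_pow_mul_exp_neg_mul_Ioi 0 (sub_pos.mpr hy1)
    simp only [pow_zero, one_mul, Nat.factorial_zero, Nat.cast_one, zero_add, pow_one] at i1 i2
    rw [← integral_pow_mul_exp_neg_mul_Ioi _ hy0, ← i1, ← integral_const_mul,
      ← integral_const_mul]
    refine setIntegral_mono_on ((integrableOn_pow_mul_exp_neg_mul_Ioi _ hy0).const_mul _)
      (i2.const_mul _) measurableSet_Ioi fun x hx => ?_
    have hx : 0 < x := hx
    have := norm_coeff_mul_pow_le hc hd hx (M := C * Real.exp (σ * x))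
      (fun z hz => hz ▸ hM z) k
    calc ‖c k‖ * (x ^ (2 * k) * Real.exp (-(y * x)))
        = ‖c k‖ * x ^ (2 * k) * Real.exp (-(y * x)) := by ring
      _ ≤ C * Real.exp (σ * x) * Real.exp (-(y * x)) := by gcongr
      _ = C * Real.exp (-((y - σ) * x)) := by
        rw [mul_assoc, ← Real.exp_add]; ring_nf
  have hg : Summable fun k : ℕ => C * (1 / (y - σ)) * ((y / ρ) * ((y / ρ) ^ 2) ^ k) := by
    refine ((summable_geometric_of_lt_one (by positivity) ?_).mul_left _).mul_left _
    have : y / ρ < 1 := (div_lt_one hρ0).mpr hy2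
    have : 0 < y / ρ := by positivity
    nlinarith
  refine Summable.of_nonneg_of_le (fun k => by positivity) (fun k => ?_) hg
  calc ‖c k‖ * ((2 * k).factorial / ρ ^ (2 * k + 1))
      = ‖c k‖ * ((2 * k).factorial / y ^ (2 * k + 1)) * (y / ρ) ^ (2 * k + 1) := by
        rw [div_pow]; field_simp
    _ ≤ C * (1 / (y - σ)) * (y / ρ) ^ (2 * k + 1) :=
        mul_le_mul_of_nonneg_right (hb k) (by positivity)
    _ = _ := by rw [← pow_mul]; ring

/-- The Borel transform `∑ c_k (2k)! (i/w)^{2k+1}` of the even power series `∑ c_k z^{2k}`. -/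
noncomputable def borelSum (c : ℕ → ℂ) (w : ℂ) : ℂ :=
  ∑' k : ℕ, c k * ((2 * k).factorial * (I / w) ^ (2 * k + 1))

theorem norm_borelSum_term_le (c : ℕ → ℂ) {ρ : ℝ} (hρ : 0 < ρ) {w : ℂ} (hw : ρ ≤ ‖w‖) (k : ℕ) :
    ‖c k * ((2 * k).factorial * (I / w) ^ (2 * k + 1))‖ ≤
      ‖c k‖ * ((2 * k).factorial / ρ ^ (2 * k + 1)) := by
  rw [norm_mul, norm_mul, norm_pow, norm_div, Complex.norm_I, Complex.norm_natCast, one_div,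
    inv_pow, ← div_eq_mul_inv]
  gcongr

theorem borelSum_neg (c : ℕ → ℂ) (w : ℂ) : borelSum c (-w) = -borelSum c w := by
  rw [borelSum, borelSum, ← tsum_neg]
  refine tsum_congr fun k => ?_
  rw [div_neg, Odd.neg_pow ⟨k, rfl⟩]
  ring

theorem differentiableOn_borelSum {c : ℕ → ℂ} {ρ : ℝ} (hρ : 0 < ρ)
    (hs : Summable fun k => ‖c k‖ * ((2 * k).factorial / ρ ^ (2 * k + 1))) :
    DifferentiableOn ℂ (borelSum c) {w | ρ < ‖w‖} := by
  refine differentiableOn_tsum_of_summable_norm hs (fun k => ?_)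
    (isOpen_lt continuous_const continuous_norm)
    (fun k w hw => norm_borelSum_term_le c hρ (le_of_lt hw) k)
  intro w hw
  have hw0 : w ≠ 0 := norm_pos_iff.mp (hρ.trans hw)
  refine DifferentiableAt.differentiableWithinAt ?_
  fun_prop (disch := assumption)

/-! ### Identification of the two transforms -/

theorem halfFourier_mul_I_eq_borelSum {h : ℂ → ℂ} {c : ℕ → ℂ}
    (hc : ∀ z, HasSum (fun k => c k * z ^ (2 * k)) (h z)) {ρ : ℝ} (hρ : 0 < ρ)
    (hs : Summable fun k => ‖c k‖ * ((2 * k).factorial / ρ ^ (2 * k + 1)))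
    {y : ℝ} (hy : ρ ≤ y) : halfFourier h (y * I) = borelSum c (y * I) := by
  have hy0 : 0 < y := hρ.trans_le hy
  have hF : ∀ (k : ℕ) (x : ℝ), c k * (x : ℂ) ^ (2 * k) * exp (y * I * x * I) =
      c k * ((x ^ (2 * k) * Real.exp (-(y * x)) : ℝ) : ℂ) := fun k x => by
    push_cast
    have : (y : ℂ) * I * x * I = -(y * x) := by linear_combination (y * x : ℂ) * I_sq
    rw [this]; ring
  have hint : ∀ k : ℕ, IntegrableOn (fun x : ℝ => c k * (x : ℂ) ^ (2 * k) * exp (y * I * x * I))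
      (Ioi 0) := fun k => by
    simp_rw [hF]
    exact ((integrableOn_pow_mul_exp_neg_mul_Ioi (2 * k) hy0).ofReal).const_mul _
  have hn : ∀ k : ℕ, ∫ x in Ioi (0 : ℝ), ‖c k * (x : ℂ) ^ (2 * k) * exp (y * I * x * I)‖ =
      ‖c k‖ * ((2 * k).factorial / y ^ (2 * k + 1)) := fun k => by
    simp_rw [hF]
    rw [← integral_pow_mul_exp_neg_mul_Ioi _ hy0, ← integral_const_mul]
    refine setIntegral_congr_fun measurableSet_Ioi fun x hx => ?_
    have hx : 0 < x := hx
    rw [norm_mul, Complex.norm_real, Real.norm_of_nonneg (by positivity)]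
  have hsy : Summable fun k => ‖c k‖ * ((2 * k).factorial / y ^ (2 * k + 1)) :=
    hs.of_nonneg_of_le (fun k => by positivity) fun k => by gcongr
  have key := hasSum_integral_of_summable_integral_norm hint (by simp_rw [hn]; exact hsy)
  have e : ∫ x in Ioi (0 : ℝ), ∑' k : ℕ, c k * (x : ℂ) ^ (2 * k) * exp (y * I * x * I) =
      halfFourier h (y * I) := by
    rw [halfFourier]
    congr 1
    ext x
    exact ((hc x).mul_right _).tsum_eq
  rw [e] at key
  rw [← key.tsum_eq, borelSum]
  refine tsum_congr fun k => ?_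
  simp_rw [hF]
  rw [integral_const_mul, integral_complex_ofReal, integral_pow_mul_exp_neg_mul_Ioi _ hy0]
  have hyc : (y : ℂ) ≠ 0 := by exact_mod_cast hy0.ne'
  have : I / (y * I) = 1 / y := by field_simp
  rw [this]
  push_cast
  rw [one_div, inv_pow, div_eq_mul_inv]

/-- The region is the image under `exp` of a convex half-strip. -/
theorem isPreconnected_upperHalfPlane_diff_disk {ρ : ℝ} (hρ : 0 < ρ) :
    IsPreconnected {w : ℂ | 0 < w.im ∧ ρ < ‖w‖} := by
  have : {w : ℂ | 0 < w.im ∧ ρ < ‖w‖} = exp '' (Ioi (Real.log ρ) ×ℂ Ioo 0 Real.pi) := by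
    ext w
    constructor
    · rintro ⟨h1, h2⟩
      have hw : w ≠ 0 := norm_pos_iff.mp (hρ.trans h2)
      refine ⟨log w, ?_, exp_log hw⟩
      rw [Complex.mem_reProdIm, Complex.log_re, Complex.log_im]
      refine ⟨Real.log_lt_log hρ h2, ?_, Complex.arg_lt_pi_iff.mpr (Or.inr h1.ne')⟩
      refine lt_of_le_of_ne (Complex.arg_nonneg_iff.mpr h1.le) fun h0 => ?_
      exact h1.ne' (Complex.arg_eq_zero_iff.mp h0.symm).2
    · rintro ⟨s, hs, rfl⟩
      rw [Complex.mem_reProdIm] at hs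
      refine ⟨?_, ?_⟩
      · rw [Complex.exp_im]
        exact mul_pos (Real.exp_pos _) (Real.sin_pos_of_mem_Ioo hs.2)
      · rw [Complex.norm_exp]
        exact (Real.log_lt_iff_lt_exp hρ).mp hs.1
  rw [this]
  have hconv : Convex ℝ (Ioi (Real.log ρ) ×ℂ Ioo 0 Real.pi) :=
    ((convex_Ioi (Real.log ρ)).linear_preimage Complex.reLm).inter
      ((convex_Ioo 0 Real.pi).linear_preimage Complex.imLm)
  exact hconv.isPreconnected.image _ continuous_exp.continuousOn

/-- The two sides agree high on the imaginary axis, hence on the open region by the identity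
theorem, and on its real boundary by continuity. The contour shift needs the real points. -/
theorem halfFourier_eq_borelSum {h : ℂ → ℂ} {c : ℕ → ℂ} (hd : Continuous h)
    (hi : IntegrableOn (fun x : ℝ => h x) (Ioi 0))
    (hc : ∀ z, HasSum (fun k => c k * z ^ (2 * k)) (h z)) {ρ : ℝ} (hρ : 0 < ρ)
    (hs : Summable fun k => ‖c k‖ * ((2 * k).factorial / ρ ^ (2 * k + 1)))
    {w : ℂ} (hw : 0 ≤ w.im) (hw' : ρ < ‖w‖) : halfFourier h w = borelSum c w := by
  set U := {w : ℂ | 0 < w.im ∧ ρ < ‖w‖} with hU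
  have hUo : IsOpen U := (isOpen_lt continuous_const Complex.continuous_im).inter
    (isOpen_lt continuous_const continuous_norm)
  have hG : AnalyticOnNhd ℂ (halfFourier h) U :=
    ((differentiableOn_halfFourier hd hi).mono fun w hw => hw.1).analyticOnNhd hUo
  have hB : AnalyticOnNhd ℂ (borelSum c) U :=
    ((differentiableOn_borelSum hρ hs).mono fun w hw => hw.2).analyticOnNhd hUo
  have hz : ((2 * ρ : ℝ) : ℂ) * I ∈ U := by
    refine ⟨by simpa using hρ, ?_⟩
    rw [norm_mul, Complex.norm_I, Complex.norm_real, Real.norm_of_nonneg (by positivity)]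
    linarith
  have hE : EqOn (halfFourier h) (borelSum c) U := by
    refine hG.eqOn_of_preconnected_of_frequently_eq hB
      (isPreconnected_upperHalfPlane_diff_disk hρ) hz ?_
    have ht : Filter.Tendsto (fun t : ℝ => ((2 * ρ + t : ℝ) : ℂ) * I) (nhdsWithin 0 (Ioi 0))
        (nhdsWithin (((2 * ρ : ℝ) : ℂ) * I) {((2 * ρ : ℝ) : ℂ) * I}ᶜ) := by
      refine tendsto_nhdsWithin_iff.mpr ⟨?_, ?_⟩
      · have : Continuous fun t : ℝ => ((2 * ρ + t : ℝ) : ℂ) * I := by fun_prop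
        exact (this.tendsto' 0 _ (by simp)).mono_left nhdsWithin_le_nhds
      · filter_upwards [self_mem_nhdsWithin] with t ht
        have ht : 0 < t := ht
        simp [ht.ne']
    refine ht.frequently (Filter.Eventually.frequently ?_)
    filter_upwards [self_mem_nhdsWithin] with t ht
    have ht : 0 < t := ht
    exact halfFourier_mul_I_eq_borelSum hc hρ hs (by linarith)
  have hcl : w ∈ closure U := by
    have hct : Continuous fun t : ℝ => w + t * I := by fun_prop
    have ht : Filter.Tendsto (fun t : ℝ => w + t * I) (nhdsWithin 0 (Ioi 0)) (nhds w) :=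
      (hct.tendsto' 0 _ (by simp)).mono_left nhdsWithin_le_nhds
    refine mem_closure_of_tendsto ht ?_
    have hn : ∀ᶠ t : ℝ in nhdsWithin 0 (Ioi 0), ρ < ‖w + t * I‖ :=
      ht.norm.eventually (lt_mem_nhds hw')
    filter_upwards [hn, self_mem_nhdsWithin] with t ht1 ht2
    have ht2 : 0 < t := ht2
    exact ⟨by simpa using add_pos_of_nonneg_of_pos hw ht2, ht1⟩
  refine hE.of_subset_closure (t := insert w U) ?_ ?_ (subset_insert _ _)
    (insert_subset hcl subset_closure) (mem_insert _ _)
  · exact (continuousOn_halfFourier hd hi).mono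
      (insert_subset hw fun v hv => (le_of_lt hv.1 : (0 : ℝ) ≤ v.im))
  · exact (differentiableOn_borelSum hρ hs).continuousOn.mono
      (insert_subset hw' fun v hv => hv.2)

/-! ### The contour shift -/

theorem sin_re_im (x y : ℝ) : (sin (x + y * I)).re = Real.sin x * Real.cosh y ∧
    (sin (x + y * I)).im = Real.cos x * Real.sinh y := by
  rw [Complex.sin_add_mul_I, ← Complex.ofReal_sin, ← Complex.ofReal_cos, ← Complex.ofReal_sinh,
    ← Complex.ofReal_cosh]
  simp only [add_re, mul_re, add_im, mul_im, ofReal_re, ofReal_im, I_re, I_im]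
  constructor <;> ring

/-- `|sin(x + iy)|² = sin² x + sinh² y`. This keeps `λ sin z` outside the disk of radius `ρ` on the
raised segment. -/
theorem sinh_le_norm_sin (x y : ℝ) : Real.sinh y ≤ ‖sin (x + y * I)‖ := by
  refine Real.le_sqrt_of_sq_le ?_ |>.trans_eq (Complex.norm_eq_sqrt_sq_add_sq _).symm
  rw [(sin_re_im x y).1, (sin_re_im x y).2]
  nlinarith [Real.sin_sq_add_cos_sq x, Real.cosh_sq y, sq_nonneg (Real.sin x)]

/-- Shifting the contour of `∫ sin((2l+1)z) G(λ sin z) dz` upwards, where `G` is the half-line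
Fourier transform of `h`: the two vertical sides cancel. -/
theorem integral_sin_mul_halfFourier_shift {h : ℂ → ℂ} {c : ℕ → ℂ} (hd : Continuous h)
    (hi : IntegrableOn (fun x : ℝ => h x) (Ioi 0))
    (hc : ∀ z, HasSum (fun k => c k * z ^ (2 * k)) (h z)) {ρ : ℝ} (hρ : 0 < ρ)
    (hs : Summable fun k => ‖c k‖ * ((2 * k).factorial / ρ ^ (2 * k + 1)))
    {lam : ℝ} (hlam : ρ < lam) (l : ℕ) {T : ℝ} (hT : 0 ≤ T) :
    ∫ θ in (-(Real.pi / 2))..(Real.pi / 2),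
        sin ((2 * l + 1 : ℕ) * (θ : ℂ)) * halfFourier h (lam * sin θ) =
      ∫ θ in (-(Real.pi / 2))..(Real.pi / 2),
        sin ((2 * l + 1 : ℕ) * (θ + T * I)) * halfFourier h (lam * sin (θ + T * I)) := by
  set F : ℂ → ℂ := fun z => sin ((2 * l + 1 : ℕ) * z) * halfFourier h (lam * sin z) with hF
  have hl0 : 0 < lam := hρ.trans hlam
  have hpi := Real.pi_pos
  have him : ∀ x y : ℝ, ((lam : ℂ) * sin (x + y * I)).im = lam * (Real.cos x * Real.sinh y) :=
    fun x y => by rw [Complex.im_ofReal_mul, (sin_re_im x y).2]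
  have hcont : ContinuousOn F
      (uIcc (-(Real.pi / 2)) (Real.pi / 2) ×ℂ uIcc 0 T) := by
    rw [uIcc_of_le (by linarith), uIcc_of_le hT]
    refine ContinuousOn.mul (Continuous.continuousOn (by fun_prop)) ?_
    refine (continuousOn_halfFourier hd hi).comp (Continuous.continuousOn (by fun_prop)) ?_
    intro z hz
    rw [Complex.mem_reProdIm] at hz
    have := him z.re z.im
    rw [Complex.re_add_im] at this
    rw [mem_ofPred_eq, this]
    exact mul_nonneg hl0.le (mul_nonneg (Real.cos_nonneg_of_mem_Icc hz.1)
      (Real.sinh_nonneg_iff.mpr hz.2.1))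
  have hdiff : DifferentiableOn ℂ F (Ioo (min (-(Real.pi / 2)) (Real.pi / 2))
      (max (-(Real.pi / 2)) (Real.pi / 2)) ×ℂ Ioo (min 0 T) (max 0 T)) := by
    rw [min_eq_left (by linarith), max_eq_right (by linarith), min_eq_left hT, max_eq_right hT]
    refine DifferentiableOn.mul (Differentiable.differentiableOn (by fun_prop)) ?_
    refine (differentiableOn_halfFourier hd hi).comp
      (Differentiable.differentiableOn (by fun_prop)) ?_
    intro z hz
    rw [Complex.mem_reProdIm] at hz
    have := him z.re z.im
    rw [Complex.re_add_im] at this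
    rw [mem_ofPred_eq, this]
    exact mul_pos hl0 (mul_pos (Real.cos_pos_of_mem_Ioo hz.1) (Real.sinh_pos_iff.mpr hz.2.1))
  -- Under `z ↦ z + π` both `sin((2l+1)z)` and `G(λ sin z)` change sign, the latter because `λ sin z
  -- = ∓λ cosh y` is real of modulus at least `λ > ρ`, where `G` is odd.
  have hside : ∀ y : ℝ, F ((Real.pi / 2 : ℝ) + y * I) = F ((-(Real.pi / 2) : ℝ) + y * I) := by
    intro y
    set v : ℂ := (-(Real.pi / 2) : ℝ) + y * I with hv
    have e1 : ((Real.pi / 2 : ℝ) : ℂ) + y * I = v + Real.pi := by rw [hv]; push_cast; ring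
    have e2 : ((2 * l + 1 : ℕ) : ℂ) * (v + Real.pi) =
        (2 * l + 1 : ℕ) * v + Real.pi + l * (2 * Real.pi) := by push_cast; ring
    have e3 : (lam : ℂ) * sin v = ((-(lam * Real.cosh y) : ℝ) : ℂ) := by
      rw [hv, Complex.sin_add_mul_I, ← Complex.ofReal_sin, ← Complex.ofReal_cos, Real.sin_neg,
        Real.cos_neg, Real.sin_pi_div_two, Real.cos_pi_div_two]
      push_cast; ring
    have hn : ρ < lam * Real.cosh y := by nlinarith [Real.one_le_cosh y]
    have e4 : halfFourier h (-(lam * sin v)) = - halfFourier h (lam * sin v) := by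
      rw [halfFourier_eq_borelSum hd hi hc hρ hs, halfFourier_eq_borelSum hd hi hc hρ hs,
        borelSum_neg]
      · rw [e3]; simp
      · rw [e3, Complex.norm_real, norm_neg, Real.norm_of_nonneg (by linarith)]; exact hn
      · rw [e3]; simp
      · rw [e3, norm_neg, Complex.norm_real, norm_neg, Real.norm_of_nonneg (by linarith)]
        exact hn
    simp only [hF]
    rw [e1, e2, Complex.sin_add_nat_mul_two_pi, Complex.sin_add_pi, Complex.sin_add_pi, mul_neg,
      e4]
    ring
  have key := Complex.integral_boundary_rect_eq_zero_of_continuousOn_of_differentiableOn F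
    ((-(Real.pi / 2) : ℝ) : ℂ) ((Real.pi / 2 : ℝ) + T * I) (by simpa using hcont)
    (by simpa using hdiff)
  have r1 : (((Real.pi / 2 : ℝ) : ℂ) + T * I).re = Real.pi / 2 := by simp
  have r2 : (((Real.pi / 2 : ℝ) : ℂ) + T * I).im = T := by simp
  rw [r1, r2, Complex.ofReal_re, Complex.ofReal_im] at key
  simp_rw [hside] at key
  rw [add_sub_cancel_right, sub_eq_zero] at key
  rw [Complex.ofReal_zero] at key
  simpa only [zero_mul, add_zero] using key

/-! ### Evaluation on the raised segment -/

theorem I_div_mul_sin_eq (lam : ℝ) {z : ℂ} (hz : 0 < z.im) :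
    I / (lam * sin z) = 2 / lam * (exp (z * I) / (1 - exp (z * I) ^ 2)) := by
  have hq : exp (z * I) ≠ 0 := exp_ne_zero _
  have hq1 : 1 - exp (z * I) ^ 2 ≠ 0 := by
    intro h0
    have h1 : ‖exp (z * I) ^ 2‖ = 1 := by rw [← sub_eq_zero.mp h0, norm_one]
    rw [norm_pow, Complex.norm_exp] at h1
    have h2 : Real.exp (z * I).re < 1 := Real.exp_lt_one_iff.mpr (by simpa using hz)
    nlinarith [Real.exp_pos (z * I).re]
  have hs : sin z = (1 - exp (z * I) ^ 2) / exp (z * I) * I / 2 := by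
    rw [Complex.sin, show -z * I = -(z * I) by ring, Complex.exp_neg]
    field_simp
  -- For `lam = 0` both sides are `0`, as division by zero gives `0`.
  by_cases hl : (lam : ℂ) = 0
  · simp [hl]
  rw [hs]
  field_simp

theorem sin_mul_exp_pow_eq (l k j : ℕ) (z : ℂ) :
    sin ((2 * l + 1 : ℕ) * z) * exp (z * I) ^ (2 * k + 1 + 2 * j) =
      I / 2 * (exp (2 * ((k + j : ℤ) - l : ℤ) * z * I) -
        exp (2 * ((k + j + l + 1 : ℕ) : ℤ) * z * I)) := by
  have e : ∀ a b : ℂ, exp a * exp b = exp (a + b) := fun a b => (Complex.exp_add a b).symm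
  rw [Complex.sin, ← Complex.exp_nat_mul, div_mul_eq_mul_div, mul_right_comm, sub_mul, e, e,
    mul_div_assoc, mul_comm]
  congr 2 <;> (congr 1; push_cast; ring)

/-- The moments of `sin((2l+1)z)` against odd negative powers of `sin z` on a shifted half
period. -/
theorem integral_sin_mul_inv_sin_pow (l k : ℕ) (lam : ℝ) {T : ℝ} (hT : 0 < T) :
    ∫ θ in (-(Real.pi / 2))..(Real.pi / 2),
        sin ((2 * l + 1 : ℕ) * (θ + T * I)) * (I / (lam * sin (θ + T * I))) ^ (2 * k + 1) =
      if k ≤ l then (2 / (lam : ℂ)) ^ (2 * k + 1) * (I / 2) * Real.pi * ((l + k).choose (2 * k))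
        else 0 := by
  set r : ℝ := Real.exp (-T) with hr
  have hr1 : r < 1 := Real.exp_lt_one_iff.mpr (by linarith)
  have hr0 : 0 < r := Real.exp_pos _
  have hq : ∀ θ : ℝ, ‖exp ((θ + T * I) * I) ^ 2‖ = r ^ 2 := fun θ => by
    rw [norm_pow, Complex.norm_exp]; simp [hr]
  have hq1 : r ^ 2 < 1 := by nlinarith
  -- The negative binomial series of `(1 - q²)^{-(2k+1)}`, convergent since `|q| = e^{-T} < 1`.
  have hpt : ∀ θ : ℝ, HasSum (fun j : ℕ => (((j + 2 * k).choose (2 * k) : ℕ) : ℂ) *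
      ((2 / (lam : ℂ)) ^ (2 * k + 1) * (sin ((2 * l + 1 : ℕ) * (θ + T * I)) *
        exp ((θ + T * I) * I) ^ (2 * k + 1 + 2 * j))))
      (sin ((2 * l + 1 : ℕ) * (θ + T * I)) * (I / (lam * sin (θ + T * I))) ^ (2 * k + 1)) := by
    intro θ
    have h1 := (hasSum_choose_mul_geometric_of_norm_lt_one (2 * k)
      (r := exp ((θ + T * I) * I) ^ 2) (by rw [hq]; exact hq1)).mul_left
      ((2 / (lam : ℂ)) ^ (2 * k + 1) * (sin ((2 * l + 1 : ℕ) * (θ + T * I)) *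
        exp ((θ + T * I) * I) ^ (2 * k + 1)))
    rw [I_div_mul_sin_eq lam (by simpa using hT), mul_pow, div_pow (exp ((θ + T * I) * I))]
    refine (congrArg₂ (fun f a => HasSum f a) (funext fun j => ?_) ?_).mp h1
    · rw [← pow_mul, pow_add _ (2 * k + 1)]; ring
    · ring
  have hb : Summable fun j : ℕ => (((j + 2 * k).choose (2 * k) : ℕ) : ℝ) * (r ^ 2) ^ j :=
    (hasSum_choose_mul_geometric_of_norm_lt_one (2 * k)
      (r := r ^ 2) (by rwa [Real.norm_of_nonneg (by positivity)])).summable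
  have hi := intervalIntegral.hasSum_integral_of_dominated_convergence (μ := volume)
    (a := -(Real.pi / 2)) (b := Real.pi / 2)
    (fun (j : ℕ) (θ : ℝ) => ((((j + 2 * k).choose (2 * k) : ℕ) : ℝ) * (r ^ 2) ^ j) *
      ‖(2 / (lam : ℂ)) ^ (2 * k + 1) * (sin ((2 * l + 1 : ℕ) * (θ + T * I)) *
        exp ((θ + T * I) * I) ^ (2 * k + 1))‖)
    (fun j => Continuous.aestronglyMeasurable (by fun_prop))
    (fun j => Filter.Eventually.of_forall fun θ _ => by
      rw [pow_add _ (2 * k + 1), pow_mul _ 2 j, ← mul_assoc (sin _), ← mul_assoc (_ ^ _),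
        norm_mul, norm_mul _ ((_ ^ 2) ^ j), norm_pow _ j, hq, Complex.norm_natCast]
      exact le_of_eq (by ring))
    (Filter.Eventually.of_forall fun θ _ => hb.mul_right _)
    (by
      simp_rw [tsum_mul_right]
      exact Continuous.intervalIntegrable (by fun_prop) _ _)
    (Filter.Eventually.of_forall fun θ _ => hpt θ)
  have hterm : ∀ j : ℕ, ∫ θ in (-(Real.pi / 2))..(Real.pi / 2),
      (((j + 2 * k).choose (2 * k) : ℕ) : ℂ) *
      ((2 / (lam : ℂ)) ^ (2 * k + 1) * (sin ((2 * l + 1 : ℕ) * (θ + T * I)) *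
        exp ((θ + T * I) * I) ^ (2 * k + 1 + 2 * j))) =
      (((j + 2 * k).choose (2 * k) : ℕ) : ℂ) * ((2 / (lam : ℂ)) ^ (2 * k + 1) *
        (I / 2 * if k + j = l then (Real.pi : ℂ) else 0)) := by
    intro j
    -- Of the two frequencies, `k + j + l + 1` is never zero and `k + j - l` vanishes only at `j = l
    -- - k`.
    simp_rw [sin_mul_exp_pow_eq]
    rw [intervalIntegral.integral_const_mul, intervalIntegral.integral_const_mul,
      intervalIntegral.integral_const_mul, intervalIntegral.integral_sub
        (Continuous.intervalIntegrable (by fun_prop) _ _)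
        (Continuous.intervalIntegrable (by fun_prop) _ _),
      integral_exp_two_mul_half_period, integral_exp_two_mul_half_period,
      if_neg (by omega : ¬ ((k + j + l + 1 : ℕ) : ℤ) = 0), sub_zero]
    congr 4
    apply propext
    omega
  simp_rw [hterm] at hi
  split_ifs with hkl
  · have h2 := hasSum_single (f := fun j : ℕ => (((j + 2 * k).choose (2 * k) : ℕ) : ℂ) *
      ((2 / (lam : ℂ)) ^ (2 * k + 1) * (I / 2 * if k + j = l then (Real.pi : ℂ) else 0)))
      (l - k) (fun j hj => by
        rw [if_neg (by omega)]; ring)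
    rw [hi.unique h2, if_pos (by omega), show l - k + 2 * k = l + k by omega]
    ring
  · have h2 : (fun j : ℕ => (((j + 2 * k).choose (2 * k) : ℕ) : ℂ) *
      ((2 / (lam : ℂ)) ^ (2 * k + 1) * (I / 2 * if k + j = l then (Real.pi : ℂ) else 0))) =
      fun _ => 0 := by
      funext j
      rw [if_neg (by omega)]; ring
    rw [h2] at hi
    exact hi.unique hasSum_zero

theorem integral_sin_mul_borelSum {c : ℕ → ℂ} {ρ : ℝ} (hρ : 0 < ρ)
    (hs : Summable fun k => ‖c k‖ * ((2 * k).factorial / ρ ^ (2 * k + 1)))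
    {lam : ℝ} (hlam : 0 < lam) (l : ℕ) {T : ℝ} (hT : 0 < T) (hT' : ρ ≤ lam * Real.sinh T) :
    ∫ θ in (-(Real.pi / 2))..(Real.pi / 2),
        sin ((2 * l + 1 : ℕ) * (θ + T * I)) * borelSum c (lam * sin (θ + T * I)) =
      ∑ k ∈ Finset.range (l + 1), c k * ((2 * k).factorial *
        ((2 / (lam : ℂ)) ^ (2 * k + 1) * (I / 2) * Real.pi * ((l + k).choose (2 * k)))) := by
  have hn : ∀ θ : ℝ, ρ ≤ ‖(lam : ℂ) * sin (θ + T * I)‖ := fun θ => by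
    rw [norm_mul, Complex.norm_real, Real.norm_of_nonneg hlam.le]
    exact hT'.trans (mul_le_mul_of_nonneg_left (sinh_le_norm_sin θ T) hlam.le)
  have hne : ∀ θ : ℝ, (lam : ℂ) * sin (θ + T * I) ≠ 0 := fun θ =>
    norm_pos_iff.mp (hρ.trans_le (hn θ))
  have hc1 : ∀ k : ℕ, Continuous fun θ : ℝ => sin ((2 * l + 1 : ℕ) * (θ + T * I)) *
      (c k * ((2 * k).factorial * (I / (lam * sin (θ + T * I))) ^ (2 * k + 1))) := fun k => by
    have : Continuous fun θ : ℝ => I / (lam * sin (θ + T * I)) :=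
      Continuous.div (by fun_prop) (by fun_prop) hne
    fun_prop
  have hi := intervalIntegral.hasSum_integral_of_dominated_convergence (μ := volume)
    (a := -(Real.pi / 2)) (b := Real.pi / 2)
    (F := fun (k : ℕ) (θ : ℝ) => sin ((2 * l + 1 : ℕ) * (θ + T * I)) *
      (c k * ((2 * k).factorial * (I / (lam * sin (θ + T * I))) ^ (2 * k + 1))))
    (f := fun θ : ℝ => sin ((2 * l + 1 : ℕ) * (θ + T * I)) * borelSum c (lam * sin (θ + T * I)))
    (fun (k : ℕ) (θ : ℝ) => ‖sin ((2 * l + 1 : ℕ) * (θ + T * I))‖ *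
      (‖c k‖ * ((2 * k).factorial / ρ ^ (2 * k + 1))))
    (fun k => (hc1 k).aestronglyMeasurable)
    (fun k => Filter.Eventually.of_forall fun θ _ => by
      rw [norm_mul]
      exact mul_le_mul_of_nonneg_left (norm_borelSum_term_le c hρ (hn θ) k) (norm_nonneg _))
    (Filter.Eventually.of_forall fun θ _ => hs.mul_left _)
    (by
      simp_rw [tsum_mul_left]
      exact Continuous.intervalIntegrable (by fun_prop) _ _)
    (Filter.Eventually.of_forall fun θ _ => HasSum.mul_left _
      (Summable.of_norm_bounded hs fun k => norm_borelSum_term_le c hρ (hn θ) k).hasSum)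
  have hterm : ∀ k : ℕ, ∫ θ in (-(Real.pi / 2))..(Real.pi / 2),
      sin ((2 * l + 1 : ℕ) * (θ + T * I)) *
        (c k * ((2 * k).factorial * (I / (lam * sin (θ + T * I))) ^ (2 * k + 1))) =
      c k * ((2 * k).factorial * if k ≤ l then (2 / (lam : ℂ)) ^ (2 * k + 1) * (I / 2) *
        Real.pi * ((l + k).choose (2 * k)) else 0) := fun k => by
    rw [← integral_sin_mul_inv_sin_pow l k lam hT, ← intervalIntegral.integral_const_mul,
      ← intervalIntegral.integral_const_mul]
    congr 1
    funext θ
    ring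
  simp_rw [hterm] at hi
  rw [hi.unique (hasSum_sum_of_ne_finset_zero (s := Finset.range (l + 1)) fun k hk => by
    rw [if_neg (by simpa using hk)]; ring)]
  refine Finset.sum_congr rfl fun k hk => ?_
  rw [if_pos (by simpa [Nat.lt_succ_iff] using hk)]

/-! ### Fubini and assembly -/

theorem integrable_mul_sin_mul_exp {h : ℂ → ℂ} (hd : Continuous h)
    (hi : IntegrableOn (fun x : ℝ => h x) (Ioi 0)) (lam : ℝ) (n : ℕ) :
    Integrable (fun p : ℝ × ℝ => h p.1 * (sin (n * (p.2 : ℂ)) *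
      exp ((lam * p.1 : ℝ) * sin p.2 * I)))
      ((volume.restrict (Ioi 0)).prod
        (volume.restrict (Ioc (-(Real.pi / 2)) (Real.pi / 2)))) := by
  have h2 : Integrable (fun θ : ℝ => sin (n * (θ : ℂ)))
      (volume.restrict (Ioc (-(Real.pi / 2)) (Real.pi / 2))) :=
    ((show Continuous fun θ : ℝ => sin (n * (θ : ℂ)) by fun_prop).integrableOn_Icc).mono_set
      Ioc_subset_Icc_self
  refine (hi.mul_prod h2).mono (Continuous.aestronglyMeasurable (by fun_prop))
    (Filter.Eventually.of_forall fun p => ?_)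
  rw [norm_mul, norm_mul, norm_mul, ← Complex.ofReal_sin, ← Complex.ofReal_mul,
    Complex.norm_exp_ofReal_mul_I, mul_one]

theorem mul_besselJ_odd_eq (h : ℂ → ℂ) (lam : ℝ) (l : ℕ) (x : ℝ) :
    h x * besselJ (2 * l + 1) ((lam * x : ℝ) : ℂ) =
      (Real.pi * I)⁻¹ * ∫ θ in Ioc (-(Real.pi / 2)) (Real.pi / 2),
        h x * (sin ((2 * l + 1 : ℕ) * (θ : ℂ)) * exp ((lam * x : ℝ) * sin θ * I)) := by
  have hpi : (Real.pi * I : ℂ) ≠ 0 := by simp [Real.pi_ne_zero]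
  rw [integral_const_mul, ← intervalIntegral.integral_of_le (by linarith [Real.pi_pos]),
    besselJ_odd_eq_integral]
  field_simp

/-- The integral of an even entire function of exponential type less than `lam` against
`J_{2l+1}(lam x)`, in terms of its Taylor coefficients. -/
theorem integral_mul_besselJ_odd {h : ℂ → ℂ} {c : ℕ → ℂ} (hd : Continuous h)
    (hi : IntegrableOn (fun x : ℝ => h x) (Ioi 0))
    (hc : ∀ z, HasSum (fun k => c k * z ^ (2 * k)) (h z)) {ρ : ℝ} (hρ : 0 < ρ)
    (hs : Summable fun k => ‖c k‖ * ((2 * k).factorial / ρ ^ (2 * k + 1)))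
    {lam : ℝ} (hlam : ρ < lam) (l : ℕ) :
    ∫ x in Ioi (0 : ℝ), h x * besselJ (2 * l + 1) ((lam * x : ℝ) : ℂ) =
      1 / 2 * ∑ k ∈ Finset.range (l + 1),
        c k * (((l + k).factorial : ℂ) / ((l - k).factorial : ℂ)) *
          (2 / (lam : ℂ)) ^ (2 * k + 1) := by
  have hl0 : 0 < lam := hρ.trans hlam
  have hpi : (Real.pi * I : ℂ) ≠ 0 := by simp [Real.pi_ne_zero]
  -- Any `T > 0` with `λ sinh T > ρ` would serve; `sinh T = 1` reduces this to `λ > ρ`.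
  set T := Real.arsinh 1 with hTdef
  have hT : 0 < T := Real.arsinh_pos_iff.mpr one_pos
  have hsinh : Real.sinh T = 1 := Real.sinh_arsinh 1
  have hinner : ∀ θ : ℝ, ∫ x in Ioi (0 : ℝ),
      h x * (sin ((2 * l + 1 : ℕ) * (θ : ℂ)) * exp ((lam * x : ℝ) * sin θ * I)) =
      sin ((2 * l + 1 : ℕ) * (θ : ℂ)) * halfFourier h (lam * sin θ) := fun θ => by
    rw [halfFourier, ← integral_const_mul]
    congr 1
    funext x
    rw [show ((lam * x : ℝ) : ℂ) * sin θ * I = lam * sin θ * x * I by push_cast; ring]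
    ring
  have htop : ∫ θ in (-(Real.pi / 2))..(Real.pi / 2),
        sin ((2 * l + 1 : ℕ) * (θ + T * I)) * halfFourier h (lam * sin (θ + T * I)) =
      ∫ θ in (-(Real.pi / 2))..(Real.pi / 2),
        sin ((2 * l + 1 : ℕ) * (θ + T * I)) * borelSum c (lam * sin (θ + T * I)) := by
    refine intervalIntegral.integral_congr fun θ hθ => ?_
    rw [uIcc_of_le (by linarith [Real.pi_pos])] at hθ
    have hnorm : ρ < ‖(lam : ℂ) * sin (θ + T * I)‖ := by
      rw [norm_mul, Complex.norm_real, Real.norm_of_nonneg hl0.le]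
      have := sinh_le_norm_sin θ T
      rw [hsinh] at this
      nlinarith
    have him : 0 ≤ ((lam : ℂ) * sin (θ + T * I)).im := by
      rw [Complex.im_ofReal_mul, (sin_re_im θ T).2, hsinh, mul_one]
      exact mul_nonneg hl0.le (Real.cos_nonneg_of_mem_Icc hθ)
    exact congrArg _ (halfFourier_eq_borelSum hd hi hc hρ hs him hnorm)
  simp_rw [mul_besselJ_odd_eq]
  rw [integral_const_mul, integral_integral_swap (integrable_mul_sin_mul_exp hd hi lam _)]
  simp_rw [hinner]
  rw [← intervalIntegral.integral_of_le (by linarith [Real.pi_pos]),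
    integral_sin_mul_halfFourier_shift hd hi hc hρ hs hlam l hT.le, htop,
    integral_sin_mul_borelSum hρ hs hl0 l hT (by rw [hsinh]; linarith), Finset.mul_sum,
    Finset.mul_sum]
  refine Finset.sum_congr rfl fun k hk => ?_
  have hk : k ≤ l := by simpa [Nat.lt_succ_iff] using hk
  -- `(2k)!` from the Borel transform cancels the one in the binomial coefficient.
  rw [Nat.cast_choose ℂ (by omega : 2 * k ≤ l + k), show l + k - 2 * k = l - k by omega]
  have hf : ((2 * k).factorial : ℂ) ≠ 0 := by exact_mod_cast Nat.factorial_ne_zero _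
  have hp : (Real.pi : ℂ) ≠ 0 := by exact_mod_cast Real.pi_ne_zero
  field_simp

theorem integrableOn_mul_besselJ_odd {h : ℂ → ℂ} (hd : Continuous h)
    (hi : IntegrableOn (fun x : ℝ => h x) (Ioi 0)) (lam : ℝ) (l : ℕ) :
    IntegrableOn (fun x : ℝ => h x * besselJ (2 * l + 1) ((lam * x : ℝ) : ℂ)) (Ioi 0) := by
  simp_rw [mul_besselJ_odd_eq]
  exact (integrable_mul_sin_mul_exp hd hi lam _).integral_prod_left.const_mul _

/-! ### Exponential type and the main theorem -/

/-- Liouville: negative type forces decay at infinity. -/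
theorem IsEntireOfExpType.eq_zero_of_neg {τ : ℝ} {h : ℂ → ℂ} (hexp : IsEntireOfExpType τ h)
    (hτ : τ < 0) (z : ℂ) : h z = 0 := by
  refine hexp.1.apply_eq_of_tendsto_cocompact z ?_
  obtain ⟨R, hR⟩ := hexp.2 (-τ / 2) (by linarith)
  have hn := tendsto_norm_cocompact_atTop (E := ℂ)
  have h0 : Filter.Tendsto (fun z : ℂ => Real.exp ((τ + -τ / 2) * ‖z‖)) (Filter.cocompact ℂ)
      (nhds 0) :=
    Real.tendsto_exp_atBot.comp (hn.const_mul_atTop_of_neg (by linarith))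
  refine squeeze_zero_norm' ?_ h0
  filter_upwards [hn.eventually_ge_atTop R] with z hz using hR z hz

theorem IsEntireOfExpType.exists_forall_norm_le {τ σ : ℝ} {h : ℂ → ℂ}
    (hexp : IsEntireOfExpType τ h) (hσ : 0 < σ) (hτσ : τ < σ) :
    ∃ C : ℝ, ∀ z : ℂ, ‖h z‖ ≤ C * Real.exp (σ * ‖z‖) := by
  obtain ⟨R, hR⟩ := hexp.2 (σ - τ) (by linarith)
  obtain ⟨C, hC⟩ := (isCompact_closedBall (0 : ℂ) R).exists_bound_of_continuousOn
    hexp.1.continuous.continuousOn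
  refine ⟨max 1 C, fun z => ?_⟩
  rcases le_total R ‖z‖ with hz | hz
  · have := hR z hz
    rw [add_sub_cancel] at this
    exact this.trans (le_mul_of_one_le_left (Real.exp_pos _).le (le_max_left _ _))
  · exact ((hC z (by simpa using hz)).trans (le_max_right 1 C)).trans
      (le_mul_of_one_le_right (zero_le_one.trans (le_max_left _ _))
        (Real.one_le_exp (by positivity)))

theorem theorem2 (τ : ℝ) (h : ℂ → ℂ) (hexp : IsEntireOfExpType τ h)
    (hint : MeasureTheory.IntegrableOn (fun x : ℝ => h (x : ℂ)) (Set.Ici 0))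
    (l m : ℕ) (b : ℕ → ℂ) (hb0 : b 0 ≠ 0)
    (hexpand : ∀ z : ℂ, ∃ s : ℂ, HasSum (fun j : ℕ => b j * z ^ (2 * j)) s ∧ h z = z ^ (2 * m) * s)
    (lam : ℝ) (hlam : τ < lam) :
    MeasureTheory.IntegrableOn
        (fun x : ℝ => h (x : ℂ) * besselJ (2 * l + 1) ((lam * x : ℝ) : ℂ)) (Set.Ioi 0) ∧
      (l < m →
        ∫ x in Set.Ioi (0 : ℝ), h (x : ℂ) * besselJ (2 * l + 1) ((lam * x : ℝ) : ℂ) = 0) ∧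
      (m ≤ l →
        ∫ x in Set.Ioi (0 : ℝ), h (x : ℂ) * besselJ (2 * l + 1) ((lam * x : ℝ) : ℂ) =
          1 / 2 * ∑ j ∈ Finset.range (l - m + 1),
            b j * (((l + m + j).factorial : ℂ) / ((l - m - j).factorial : ℂ)) *
              (2 / (lam : ℂ)) ^ (2 * m + 2 * j + 1)) := by
  have hI : IntegrableOn (fun x : ℝ => h x) (Ioi 0) := hint.mono_set Ioi_subset_Ici_self
  have hcont := hexp.1.continuous
  -- Absorbs the factor `z^{2m}` by shifting indices.
  set c : ℕ → ℂ := fun k => if k < m then 0 else b (k - m) with hcdef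
  have hcm : ∀ j, c (j + m) = b j := fun j => by simp [hcdef]
  have hc : ∀ z, HasSum (fun k => c k * z ^ (2 * k)) (h z) := fun z => by
    obtain ⟨s, hs, hz⟩ := hexpand z
    rw [← (add_left_injective m).hasSum_iff]
    · rw [hz]
      refine (congrArg (fun f => HasSum f _) (funext fun j => ?_)).mp (hs.mul_left (z ^ (2 * m)))
      simp only [Function.comp, hcm, mul_add, pow_add]
      ring
    · intro k hk
      have : k < m := by
        by_contra hkm
        exact hk ⟨k - m, by simp only; omega⟩
      simp [hcdef, this]
  -- Otherwise `h = 0`, contradicting `b 0 ≠ 0`.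
  have hτ : 0 ≤ τ := by
    by_contra hneg
    have := norm_coeff_mul_pow_le hc hexp.1 one_pos (M := 0)
      (fun z _ => by rw [hexp.eq_zero_of_neg (not_le.mp hneg) z, norm_zero]) m
    have hm := hcm 0
    rw [zero_add] at hm
    rw [hm, one_pow, mul_one] at this
    exact hb0 (norm_le_zero_iff.mp this)
  -- `τ < σ < ρ < λ`: `σ` bounds the growth of `h`, `ρ` is the radius beyond which the Borel
  -- transform is used.
  obtain ⟨σ, hσ1, hσ2⟩ := exists_between hlam
  obtain ⟨ρ, hρ1, hρ2⟩ := exists_between hσ2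
  have hσ0 : 0 < σ := hτ.trans_lt hσ1
  obtain ⟨C, hC⟩ := hexp.exists_forall_norm_le hσ0 hσ1
  have key := integral_mul_besselJ_odd hcont hI hc (hσ0.trans hρ1)
    (summable_coeff_mul_factorial hc hexp.1 hσ0 hC hρ1) hρ2 l
  refine ⟨integrableOn_mul_besselJ_odd hcont hI lam l, fun hlm => ?_, fun hml => ?_⟩
  · rw [key, Finset.sum_eq_zero, mul_zero]
    intro k hk
    have : k < m := by have := Finset.mem_range.mp hk; omega
    simp [hcdef, this]
  · rw [key, show l + 1 = m + (l - m + 1) by omega, Finset.sum_range_add,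
      Finset.sum_eq_zero (fun k hk => by simp [hcdef, Finset.mem_range.mp hk]), zero_add]
    congr 1
    refine Finset.sum_congr rfl fun j hj => ?_
    rw [add_comm m j, hcm, show l + (j + m) = l + m + j by ring,
      show l - (j + m) = l - m - j by omega,
      show 2 * (j + m) + 1 = 2 * m + 2 * j + 1 by ring]
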